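/- For a finitely generated group $K$ let $\operatorname{r}(K)$ be its rank (the minimal number of generators) and let $\tilde{\operatorname{r}}(K)=\max\{0,\operatorname{r}(K)-1\}$ be its reduced rank. For a finitely generated subgroup $H$ of a group $G$, the degree of inertia of $H$ in $G$ is $$\operatorname{di}_G(H)=\sup_K \frac{\tilde{\operatorname{r}}(H\cap K)}{\tilde{\operatorname{r}}(K)}\in[1,\infty],$$ where $K$ ranges over all finitely generated subgroups of $G$ such that $H\cap K$ is finitely generated, and $0/0$ is understood to be $1$. Let $m,n\ge 0$ be integers, let $G=\mathbb{Z}^m\times F_n$, where $F_n$ is the free group of rank $n$, and let $\pi\colon G\to F_n$ be the natural projection. Let $H$ be a finitely generated subgroup of $G$, let $H\pi$ be its image under $\pi$, and let $L_H=H\cap\mathbb{Z}^m$. Then: (i) if $\operatorname{r}(H\pi)\le 1$, then $\operatorname{di}_G(H)=1$; (ii) if $\operatorname{r}(H\pi)\ge 2$ and $[\mathbb{Z}^m:L_H]=\infty$, then $\operatorname{di}_G(H)=\infty$; (iii) if $\operatorname{r}(H\pi)\ge 2$ and $[\mathbb{Z}^m:L_H]=l<\infty$, then $\operatorname{di}_G(H)\le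 l\cdot\operatorname{di}_{F_n}(H\pi)$. -/

import Mathlib

open scoped ENNReal

/-- The rank `r(H)` of a finitely generated subgroup `H`: the minimal number of generators of `H`. -/
noncomputable def fgRank {G : Type*} [Group G] (H : Subgroup G) (hH : H.FG) : ℕ :=
  haveI : Group.FG H := (Group.fg_iff_subgroup_fg H).2 hH
  Group.rank H

/-- The reduced rank `max {0, r(H) - 1}`; natural subtraction truncates at `0`, so this is
exactly the maximum. -/
noncomputable def reducedRank {G : Type*} [Group G] (H : Subgroup G) (hH : H.FG) : ℕ :=
  fgRank H hH - 1

/-- The quotient `a / b` of two natural numbers in `[0, ∞]`, with `0 / 0` understood to be `1`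
(and `a / 0 = ∞` for `a ≠ 0`). -/
noncomputable def rankRatio (a b : ℕ) : ℝ≥0∞ :=
  if a = 0 ∧ b = 0 then 1 else (a : ℝ≥0∞) / (b : ℝ≥0∞)

/-- The degree of inertia of `H` in `G`: the supremum in `[0, ∞]` of the quotients of the reduced
ranks of `H ∩ K` and of `K`, over all finitely generated subgroups `K` of `G` whose intersection
with `H` is finitely generated. -/
noncomputable def degInertia {G : Type*} [Group G] (H : Subgroup G) : ℝ≥0∞ :=
  ⨆ (K : Subgroup G) (hK : K.FG) (hHK : (H ⊓ K).FG),
    rankRatio (reducedRank (H ⊓ K) hHK) (reducedRank K hK)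

/-- The free-abelian times free group `ℤ^m × F_n` (with `ℤ^m` written multiplicatively). -/
abbrev FreeAbTimesFree (m n : ℕ) : Type :=
  Multiplicative (Fin m → ℤ) × FreeGroup (Fin n)

/-- The natural projection `π : ℤ^m × F_n → F_n`. -/
def freeProj (m n : ℕ) : FreeAbTimesFree m n →* FreeGroup (Fin n) :=
  MonoidHom.snd (Multiplicative (Fin m → ℤ)) (FreeGroup (Fin n))

/-- `L_H = H ∩ ℤ^m`, as a subgroup of `ℤ^m`: the elements `a` with `(a, 1) ∈ H`. -/
def abelianPart {m n : ℕ} (H : Subgroup (FreeAbTimesFree m n)) :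
    Subgroup (Multiplicative (Fin m → ℤ)) :=
  H.comap (MonoidHom.inl (Multiplicative (Fin m → ℤ)) (FreeGroup (Fin n)))

/-- The image of a finitely generated subgroup under a homomorphism is finitely generated. -/
theorem fg_map_of_fg {G G' : Type*} [Group G] [Group G'] (f : G →* G') {H : Subgroup G}
    (hH : H.FG) : (H.map f).FG := by
  classical
  obtain ⟨S, rfl⟩ := hH
  exact ⟨S.image f, by rw [Finset.coe_image, MonoidHom.map_closure]⟩

/-! For finitely generated `K ≤ ℤ^m × F_n` the group `Kπ` is free, so `K → Kπ` splits and `r(K) =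
rank L_K + r(Kπ)` (`fgRank_le_latticeRank_add`, `latticeRank_add_fgRank_le`). As `L_{H ∩ K} ≤ L_K`,
bounding the quotient for `H ∩ K` and `K` by some `c ≥ 1` reduces to bounding the one for `(H ∩ K)π`
and `Kπ` (`rankRatio_inf_le`).

(i) If `Hπ` is cyclic, so is `(H ∩ K)π`, and nothing is left to bound.

(iii) An element of `Hπ ∩ Kπ` has a lift in `H` and a lift in `K`; their difference modulo `L_H`
determines its coset of `(H ∩ K)π`. So that subgroup has index at most `l`, and Schreier's
inequality costs a factor `l`.

(ii) Some `v ∈ ℤ^m` has no nontrivial power in `L_H`, and `H` contains a free group `⟨x, y⟩`. Then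
`K = ⟨x, y v, v^N⟩` has rank at most 3, but `H ∩ K` consists of the words in `x, y` whose exponent
sum in `y` is divisible by `N`, and this group has rank at least `N`. -/

/-! ### Ranks of finitely generated subgroups. -/

theorem fgRank_le_card {G : Type*} [Group G] {H : Subgroup G} (hH : H.FG) {S : Finset G}
    (hS : Subgroup.closure (S : Set G) = H) : fgRank H hH ≤ S.card := by
  subst hS
  exact Subgroup.rank_closure_finset_le_card S

theorem exists_finset_closure_eq_card_eq_fgRank {G : Type*} [Group G] {H : Subgroup G}
    (hH : H.FG) : ∃ S : Finset G, Subgroup.closure (S : Set G) = H ∧ S.card = fgRank H hH := by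
  classical
  have : Group.FG H := (Group.fg_iff_subgroup_fg H).2 hH
  obtain ⟨T, hT, hT'⟩ := Group.rank_spec H
  refine ⟨T.image H.subtype, ?_, ?_⟩
  · rw [Finset.coe_image, ← MonoidHom.map_closure, hT', ← MonoidHom.range_eq_map,
      Subgroup.range_subtype]
  · rw [Finset.card_image_of_injective _ H.subtype_injective, hT]
    rfl

theorem fgRank_congr {G : Type*} [Group G] {H K : Subgroup G} (h : H = K) (hH : H.FG)
    (hK : K.FG) : fgRank H hH = fgRank K hK := by
  subst h; rfl

theorem fgRank_eq_zero_iff {G : Type*} [Group G] {H : Subgroup G} (hH : H.FG) :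
    fgRank H hH = 0 ↔ H = ⊥ := by
  constructor
  · intro h
    obtain ⟨S, hS, hc⟩ := exists_finset_closure_eq_card_eq_fgRank hH
    rw [h, Finset.card_eq_zero] at hc
    rw [← hS, hc]
    simp
  · rintro rfl
    exact Nat.le_zero.1 (fgRank_le_card hH (S := ∅) (by simp))

/-- Subgroups of cyclic groups are cyclic. -/
theorem fgRank_le_one_of_le {G : Type*} [Group G] {P Q : Subgroup G} (hPQ : P ≤ Q)
    (hP : P.FG) (hQ : Q.FG) (h : fgRank Q hQ ≤ 1) : fgRank P hP ≤ 1 := by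
  obtain ⟨S, hS, hc⟩ := exists_finset_closure_eq_card_eq_fgRank hQ
  rw [← hc, Finset.card_le_one_iff_subset_singleton] at h
  have : ∃ g : G, Q ≤ Subgroup.zpowers g := by
    rcases isEmpty_or_nonempty G with hG | ⟨⟨g⟩⟩
    · exact (hG.false 1).elim
    · obtain ⟨x, hx⟩ := h
      refine ⟨x, ?_⟩
      rw [← hS, Subgroup.zpowers_eq_closure]
      exact Subgroup.closure_mono (by exact_mod_cast hx)
  obtain ⟨g, hg⟩ := this
  have hP' : (P.subgroupOf (Subgroup.zpowers g)).map (Subgroup.zpowers g).subtype = P := by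
    rw [Subgroup.subgroupOf_map_subtype, inf_eq_left]
    exact hPQ.trans hg
  have hcyc : IsCyclic (P.subgroupOf (Subgroup.zpowers g)) := inferInstance
  obtain ⟨x, hx⟩ := (Subgroup.isCyclic_iff_exists_zpowers_eq_top
    (P.subgroupOf (Subgroup.zpowers g))).1 hcyc
  refine fgRank_le_card hP (S := {(x : G)}) ?_
  rw [Finset.coe_singleton, ← Subgroup.zpowers_eq_closure, ← hP', ← hx]
  exact (MonoidHom.map_zpowers (Subgroup.zpowers g).subtype x).symm

/-- Adding coset representatives to generators of `P` generates `Q`. In (iii) this makes `Hπ ∩ Kπ`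
finitely generated, so that `Kπ` is admissible in the supremum for `Hπ`. -/
theorem Subgroup.FG.of_le_of_relIndex_ne_zero {G : Type*} [Group G] {P Q : Subgroup G}
    (hP : P.FG) (hPQ : P ≤ Q) (h : P.relIndex Q ≠ 0) : Q.FG := by
  classical
  have : Finite (Q ⧸ P.subgroupOf Q) := Nat.finite_of_card_ne_zero h
  have hfin : (Set.range fun q : Q ⧸ P.subgroupOf Q => ((q.out : Q) : G)).Finite :=
    Set.finite_range _
  have hQ : Q = P ⊔ Subgroup.closure
      (Set.range fun q : Q ⧸ P.subgroupOf Q => ((q.out : Q) : G)) := by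
    apply le_antisymm
    · intro x hx
      set q : Q ⧸ P.subgroupOf Q := QuotientGroup.mk ⟨x, hx⟩ with hq
      have h1 : (q.out)⁻¹ * (⟨x, hx⟩ : Q) ∈ P.subgroupOf Q :=
        QuotientGroup.eq.1 (by rw [QuotientGroup.out_eq'])
      have h2 : ((q.out : Q) : G)⁻¹ * x ∈ P := h1
      rw [← mul_inv_cancel_left ((q.out : Q) : G) x]
      exact Subgroup.mul_mem _
        (Subgroup.mem_sup_right (Subgroup.subset_closure ⟨q, rfl⟩)) (Subgroup.mem_sup_left h2)
    · refine sup_le hPQ ((Subgroup.closure_le _).2 ?_)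
      rintro _ ⟨q, rfl⟩
      exact (q.out).2
  rw [hQ]
  exact hP.sup ((Subgroup.fg_iff _).2 ⟨_, rfl, hfin⟩)

/-! ### Schreier's lemma and the index inequality. -/

/-- A partial Schreier transversal: the `A` reached points, each written as a translate of the
base point, with one trivial Schreier generator for each of them except the base point. -/
theorem exists_partial_schreier_transversal {G X : Type*} [Group G] [MulAction G X]
    [MulAction.IsPretransitive G X] [Fintype X] [DecidableEq X] [DecidableEq G] {S : Finset G}
    (hS : Subgroup.closure (S : Set G) = ⊤) (x₀ : X) (k : ℕ) (hk : k < Fintype.card X) :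
    ∃ (A : Finset X) (τ : X → G) (E : Finset (X × G)), A.card = k + 1 ∧ x₀ ∈ A ∧ τ x₀ = 1 ∧
      (∀ y ∈ A, τ y • x₀ = y) ∧ E.card = k ∧
      ∀ e ∈ E, e.1 ∈ A ∧ e.2 ∈ S ∧ e.2 • e.1 ∈ A ∧ τ (e.2 • e.1) = e.2 * τ e.1 := by
  induction k with
  | zero => exact ⟨{x₀}, fun _ => 1, ∅, by simp, by simp, rfl, by simp, by simp, by simp⟩
  | succ k ih =>
    obtain ⟨A, τ, E, hA, h0, hτ, hτA, hE, hEA⟩ := ih (by omega)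
    -- If no edge crossed the boundary of `A`, then `A` would be invariant under `G`, hence
    -- everything by transitivity.
    have hedge : ∃ s ∈ S, ∃ y, (y ∈ A ∧ s • y ∉ A) ∨ (y ∉ A ∧ s • y ∈ A) := by
      by_contra! hcon
      have hinv : ∀ g : G, ∀ y, y ∈ A ↔ g • y ∈ A := by
        intro g
        have hg : g ∈ Subgroup.closure (S : Set G) := by rw [hS]; trivial
        induction hg using Subgroup.closure_induction with
        | mem s hs => exact fun y => ⟨(hcon s hs y).1, fun h => by
            by_contra hy; exact (hcon s hs y).2 hy h⟩
        | one => simp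
        | mul a b _ _ iha ihb =>
          intro y; rw [mul_smul, ← iha, ← ihb]
        | inv a _ iha =>
          intro y; rw [iha (a⁻¹ • y), smul_inv_smul]
      have : A = Finset.univ := by
        ext y
        obtain ⟨g, rfl⟩ := MulAction.exists_smul_eq G x₀ y
        simpa using (hinv g x₀).1 h0
      rw [this, Finset.card_univ] at hA
      omega
    obtain ⟨s, hs, y, ⟨hy, hsy⟩ | ⟨hy, hsy⟩⟩ := hedge
    · have hne : ∀ z ∈ A, z ≠ s • y := fun z hz h => hsy (h ▸ hz)
      refine ⟨insert (s • y) A, Function.update τ (s • y) (s * τ y), insert (y, s) E, ?_, ?_, ?_,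
        ?_, ?_, ?_⟩
      · rw [Finset.card_insert_of_notMem hsy, hA]
      · exact Finset.mem_insert_of_mem h0
      · rw [Function.update_of_ne (hne _ h0), hτ]
      · intro z hz
        rcases Finset.mem_insert.1 hz with rfl | hz
        · rw [Function.update_self, mul_smul, hτA y hy]
        · rw [Function.update_of_ne (hne _ hz), hτA z hz]
      · rw [Finset.card_insert_of_notMem (fun h => hsy (hEA _ h).2.2.1), hE]
      · intro e he
        rcases Finset.mem_insert.1 he with rfl | he
        · refine ⟨Finset.mem_insert_of_mem hy, hs, Finset.mem_insert_self _ _, ?_⟩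
          simp only
          rw [Function.update_self, Function.update_of_ne (hne _ hy)]
        · obtain ⟨h1, h2, h3, h4⟩ := hEA e he
          refine ⟨Finset.mem_insert_of_mem h1, h2, Finset.mem_insert_of_mem h3, ?_⟩
          rw [Function.update_of_ne (hne _ h1), Function.update_of_ne (hne _ h3), h4]
    · have hne : ∀ z ∈ A, z ≠ y := fun z hz h => hy (h ▸ hz)
      refine ⟨insert y A, Function.update τ y (s⁻¹ * τ (s • y)), insert (y, s) E, ?_, ?_, ?_,
        ?_, ?_, ?_⟩
      · rw [Finset.card_insert_of_notMem hy, hA]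
      · exact Finset.mem_insert_of_mem h0
      · rw [Function.update_of_ne (hne _ h0), hτ]
      · intro z hz
        rcases Finset.mem_insert.1 hz with rfl | hz
        · rw [Function.update_self, mul_smul, hτA _ hsy, inv_smul_smul]
        · rw [Function.update_of_ne (hne _ hz), hτA z hz]
      · rw [Finset.card_insert_of_notMem (fun h => hy (hEA _ h).1), hE]
      · intro e he
        rcases Finset.mem_insert.1 he with rfl | he
        · refine ⟨Finset.mem_insert_self _ _, hs, Finset.mem_insert_of_mem hsy, ?_⟩
          simp only
          rw [Function.update_self, Function.update_of_ne (hne _ hsy), mul_inv_cancel_left]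
        · obtain ⟨h1, h2, h3, h4⟩ := hEA e he
          refine ⟨Finset.mem_insert_of_mem h1, h2, Finset.mem_insert_of_mem h3, ?_⟩
          rw [Function.update_of_ne (hne _ h1), Function.update_of_ne (hne _ h3), h4]

/-- Schreier's lemma, with the sharp count of the generators of a point stabilizer. -/
theorem exists_finset_closure_eq_stabilizer {G X : Type*} [Group G] [MulAction G X]
    [MulAction.IsPretransitive G X] [Fintype X] {S : Finset G}
    (hS : Subgroup.closure (S : Set G) = ⊤) (x₀ : X) :
    ∃ T : Finset G, Subgroup.closure (T : Set G) = MulAction.stabilizer G x₀ ∧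
      T.card + Fintype.card X ≤ Fintype.card X * S.card + 1 := by
  classical
  have hpos : 0 < Fintype.card X := Fintype.card_pos_iff.2 ⟨x₀⟩
  obtain ⟨A, τ, E, hA, -, hτ, hτA, hE, hEA⟩ :=
    exists_partial_schreier_transversal hS x₀ (Fintype.card X - 1) (by omega)
  have hAu : A = Finset.univ := Finset.eq_univ_of_card A (by omega)
  subst hAu
  replace hτA : ∀ y, τ y • x₀ = y := fun y => hτA y (Finset.mem_univ y)
  have hτA' : ∀ y, (τ y)⁻¹ • y = x₀ := fun y => by rw [inv_smul_eq_iff, hτA]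
  set γ : X × G → G := fun e => (τ (e.2 • e.1))⁻¹ * e.2 * τ e.1 with hγ
  -- The `|X| - 1` edges in `E` have trivial Schreier generator; dropping them gives the sharp
  -- count.
  set T := (((Finset.univ : Finset X) ×ˢ S) \ E).image γ with hT
  refine ⟨T, le_antisymm ?_ ?_, ?_⟩
  · rw [Subgroup.closure_le]
    intro g hg
    obtain ⟨e, -, rfl⟩ := Finset.mem_image.1 (Finset.mem_coe.1 hg)
    rw [SetLike.mem_coe, MulAction.mem_stabilizer_iff, hγ]
    simp only [mul_smul]
    rw [hτA, hτA']
  · have key : ∀ g : G, ∀ y, (τ (g • y))⁻¹ * g * τ y ∈ Subgroup.closure (T : Set G) := by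
      intro g
      have hg : g ∈ Subgroup.closure (S : Set G) := by rw [hS]; trivial
      induction hg using Subgroup.closure_induction with
      | mem s hs =>
        intro y
        by_cases h : (y, s) ∈ E
        · have h4 := (hEA _ h).2.2.2
          simp only at h4
          rw [h4]
          simp
        · refine Subgroup.subset_closure (Finset.mem_coe.2 (Finset.mem_image.2 ⟨(y, s), ?_, rfl⟩))
          simp only [Finset.mem_sdiff, Finset.mem_product, Finset.mem_univ, true_and]
          exact ⟨hs, h⟩
      | one => simp
      | mul a b _ _ iha ihb =>
        intro y
        have := Subgroup.mul_mem _ (iha (b • y)) (ihb y)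
        rw [← mul_smul] at this
        convert this using 1
        group
      | inv a _ iha =>
        intro y
        have := Subgroup.inv_mem _ (iha (a⁻¹ • y))
        rw [smul_inv_smul] at this
        convert this using 1
        group
    intro g hg
    have := key g x₀
    rw [MulAction.mem_stabilizer_iff.1 hg, hτ] at this
    simpa using this
  · have hsub : E ⊆ (Finset.univ : Finset X) ×ˢ S := fun e he => by
      simpa using (hEA e he).2.1
    have h1 : T.card ≤ _ := Finset.card_image_le
    have h2 := Finset.card_le_card hsub
    rw [Finset.card_sdiff_of_subset hsub] at h1
    rw [Finset.card_product, Finset.card_univ] at h1 h2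
    omega

/-- Schreier's inequality `r(P) - 1 ≤ [Q : P] (r(Q) - 1)`. -/
theorem fgRank_le_relIndex_mul_reducedRank {G : Type*} [Group G] {P Q : Subgroup G}
    (hP : P.FG) (hQ : Q.FG) (hPQ : P ≤ Q) (h : P.relIndex Q ≠ 0) :
    fgRank P hP ≤ P.relIndex Q * reducedRank Q hQ + 1 := by
  classical
  have hfin : Finite (Q ⧸ P.subgroupOf Q) := Nat.finite_of_card_ne_zero h
  have := Fintype.ofFinite (Q ⧸ P.subgroupOf Q)
  have : Group.FG Q := (Group.fg_iff_subgroup_fg Q).2 hQ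
  obtain ⟨S, hc, hS⟩ := Group.rank_spec Q
  obtain ⟨T, hT, hTc⟩ := exists_finset_closure_eq_stabilizer hS
    (QuotientGroup.mk (1 : Q) : Q ⧸ P.subgroupOf Q)
  rw [MulAction.stabilizer_quotient] at hT
  have h1 : fgRank P hP ≤ (T.image Q.subtype).card := by
    refine fgRank_le_card hP ?_
    rw [Finset.coe_image, ← MonoidHom.map_closure, hT, Subgroup.subgroupOf_map_subtype,
      inf_eq_left]
    exact hPQ
  have h2 : (T.image Q.subtype).card ≤ T.card := Finset.card_image_le
  have hd : Fintype.card (Q ⧸ P.subgroupOf Q) = P.relIndex Q := by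
    rw [Subgroup.relIndex, Subgroup.index, Nat.card_eq_fintype_card]
  rw [hd] at hTc
  have hr : S.card = fgRank Q hQ := hc
  have hr' : reducedRank Q hQ = S.card - 1 := by rw [hr]; rfl
  rw [hr', Nat.mul_sub, mul_one]
  omega

/-! ### The rank formula in `ℤ^m × F_n`. -/

/-- The images of generators of `K` span `ℤ^ι`, so there are at least `|ι|` of them. -/
theorem card_le_fgRank {G ι : Type*} [Group G] [Fintype ι] [DecidableEq ι] {K : Subgroup G}
    (hK : K.FG) (f : K →* Multiplicative (ι → ℤ))
    (hf : ∀ i, ∃ k, f k = Multiplicative.ofAdd (Pi.single i 1)) :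
    Fintype.card ι ≤ fgRank K hK := by
  classical
  have : Group.FG K := (Group.fg_iff_subgroup_fg K).2 hK
  obtain ⟨S, hc, hS⟩ := Group.rank_spec K
  set T : Finset (ι → ℤ) := S.image fun k => (f k).toAdd with hT
  have hmem : ∀ k : K, (f k).toAdd ∈ Submodule.span ℤ (T : Set (ι → ℤ)) := by
    intro k
    have hk : k ∈ Subgroup.closure (S : Set K) := by rw [hS]; trivial
    induction hk using Subgroup.closure_induction with
    | mem s hs => exact Submodule.subset_span (Finset.mem_coe.2 (Finset.mem_image_of_mem _ hs))
    | one => simp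
    | mul a b _ _ iha ihb => rw [map_mul, toAdd_mul]; exact Submodule.add_mem _ iha ihb
    | inv a _ iha => rw [map_inv, toAdd_inv]; exact Submodule.neg_mem _ iha
  have htop : Submodule.span ℤ (T : Set (ι → ℤ)) = ⊤ := by
    rw [eq_top_iff, ← (Pi.basisFun ℤ ι).span_eq, Submodule.span_le]
    rintro _ ⟨i, rfl⟩
    obtain ⟨k, hk⟩ := hf i
    have := hmem k
    rw [hk] at this
    simpa using this
  have h1 := finrank_span_finset_le_card (R := ℤ) T
  rw [Set.finrank, htop, finrank_top, Module.finrank_fintype_fun_eq_card] at h1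
  exact (h1.trans Finset.card_image_le).trans hc.le

/-- The rank of a subgroup of `ℤ^m` as a free abelian group. -/
noncomputable def latticeRank {m : ℕ} (A : Subgroup (Multiplicative (Fin m → ℤ))) : ℕ :=
  Module.finrank ℤ (AddSubgroup.toIntSubmodule (Subgroup.toAddSubgroup' A))

theorem latticeRank_mono {m : ℕ} {A B : Subgroup (Multiplicative (Fin m → ℤ))} (h : A ≤ B) :
    latticeRank A ≤ latticeRank B :=
  Submodule.finrank_mono fun _ hx => h hx

theorem exists_lattice_generators {m : ℕ} (A : Subgroup (Multiplicative (Fin m → ℤ))) :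
    ∃ a : Fin (latticeRank A) → Multiplicative (Fin m → ℤ),
      Subgroup.closure (Set.range a) = A := by
  set N := AddSubgroup.toIntSubmodule (Subgroup.toAddSubgroup' A) with hN
  let b : Module.Basis (Fin (latticeRank A)) ℤ N := Module.finBasis ℤ N
  refine ⟨fun i => Multiplicative.ofAdd (b i : Fin m → ℤ), le_antisymm ?_ ?_⟩
  · rw [Subgroup.closure_le]
    rintro _ ⟨i, rfl⟩
    exact (b i).2
  · intro x hx
    have hx' := b.sum_repr ⟨x.toAdd, hx⟩
    have h2 : x = ∏ i, (Multiplicative.ofAdd (b i : Fin m → ℤ)) ^ (b.repr ⟨x.toAdd, hx⟩ i) := by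
      apply Multiplicative.toAdd.injective
      have := congrArg (Subtype.val) hx'
      simp only [Submodule.coe_sum, Submodule.coe_smul] at this
      rw [toAdd_prod]
      simp only [toAdd_zpow, toAdd_ofAdd]
      exact this.symm
    rw [h2]
    exact Subgroup.prod_mem _ fun i _ =>
      Subgroup.zpow_mem _ (Subgroup.subset_closure (Set.mem_range_self i)) _

theorem exists_lattice_coordinates {m : ℕ} (A : Subgroup (Multiplicative (Fin m → ℤ))) :
    ∃ f : A →* Multiplicative (Fin (latticeRank A) → ℤ),
      ∀ i, ∃ a, f a = Multiplicative.ofAdd (Pi.single i 1) := by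
  set N := AddSubgroup.toIntSubmodule (Subgroup.toAddSubgroup' A) with hN
  let b : Module.Basis (Fin (latticeRank A)) ℤ N := Module.finBasis ℤ N
  refine ⟨{ toFun := fun a => Multiplicative.ofAdd (b.equivFun ⟨Multiplicative.toAdd a.1, a.2⟩)
            map_one' := ?_
            map_mul' := ?_ }, ?_⟩
  · exact congrArg Multiplicative.ofAdd (map_zero b.equivFun)
  · intro x y
    exact congrArg Multiplicative.ofAdd (map_add b.equivFun
      ⟨Multiplicative.toAdd x.1, x.2⟩ ⟨Multiplicative.toAdd y.1, y.2⟩)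
  · intro i
    refine ⟨⟨Multiplicative.ofAdd (b i : Fin m → ℤ), (b i).2⟩, ?_⟩
    refine congrArg Multiplicative.ofAdd ?_
    ext j
    exact (b.equivFun_self i j).trans (by rw [Pi.single_apply]; simp only [eq_comm])

theorem mem_abelianPart {m n : ℕ} {M : Subgroup (FreeAbTimesFree m n)}
    {a : Multiplicative (Fin m → ℤ)} : a ∈ abelianPart M ↔ (a, 1) ∈ M := Iff.rfl

/-- Generators of `L_M` together with lifts of generators of `Mπ` generate `M`, since two lifts of
one element differ by an element of `L_M`. -/
theorem fgRank_le_latticeRank_add {m n : ℕ} {M : Subgroup (FreeAbTimesFree m n)} (hM : M.FG)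
    (hM' : (M.map (freeProj m n)).FG) :
    fgRank M hM ≤ latticeRank (abelianPart M) + fgRank (M.map (freeProj m n)) hM' := by
  classical
  obtain ⟨a, ha⟩ := exists_lattice_generators (abelianPart M)
  obtain ⟨S, hS, hSc⟩ := exists_finset_closure_eq_card_eq_fgRank hM'
  have hlift : ∀ s : S, ∃ x ∈ M, freeProj m n x = s := fun s => by
    have : (s : FreeGroup (Fin n)) ∈ M.map (freeProj m n) := by
      rw [← hS]; exact Subgroup.subset_closure s.2
    exact this
  choose σ hσM hσ using hlift
  set T : Finset (FreeAbTimesFree m n) :=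
    (Finset.univ.image fun i => ((a i, 1) : FreeAbTimesFree m n)) ∪ Finset.univ.image σ with hT
  have hTa : ∀ z ∈ abelianPart M, ((z, 1) : FreeAbTimesFree m n) ∈
      Subgroup.closure (T : Set (FreeAbTimesFree m n)) := by
    intro z hz
    have h : abelianPart M ≤ abelianPart (Subgroup.closure (T : Set (FreeAbTimesFree m n))) := by
      rw [← ha, Subgroup.closure_le]
      rintro _ ⟨i, rfl⟩
      exact Subgroup.subset_closure (by simp [hT])
    exact h hz
  have hTS : M.map (freeProj m n) ≤
      (Subgroup.closure (T : Set (FreeAbTimesFree m n))).map (freeProj m n) := by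
    rw [← hS, Subgroup.closure_le]
    intro s hs
    exact ⟨σ ⟨s, hs⟩, Subgroup.subset_closure (by simp [hT]), hσ _⟩
  have hTM : Subgroup.closure (T : Set (FreeAbTimesFree m n)) ≤ M := by
    rw [Subgroup.closure_le]
    intro x hx
    rw [Finset.mem_coe, hT, Finset.mem_union, Finset.mem_image, Finset.mem_image] at hx
    rcases hx with ⟨i, -, rfl⟩ | ⟨s, -, rfl⟩
    · have : a i ∈ abelianPart M := by rw [← ha]; exact Subgroup.subset_closure ⟨i, rfl⟩
      exact this
    · exact hσM s
  have hcl : Subgroup.closure (T : Set (FreeAbTimesFree m n)) = M := by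
    refine le_antisymm hTM fun x hx => ?_
    obtain ⟨y, hy, hyx⟩ := hTS (Subgroup.mem_map_of_mem (freeProj m n) hx)
    have hyx' : y.2 = x.2 := hyx
    have h1 : x * y⁻¹ = ((x.1 * y.1⁻¹, 1) : FreeAbTimesFree m n) :=
      Prod.ext rfl (by simp [hyx'])
    have h2 := hTa (x.1 * y.1⁻¹)
      (by rw [mem_abelianPart, ← h1]; exact M.mul_mem hx (M.inv_mem (hTM hy)))
    rw [← h1] at h2
    simpa using Subgroup.mul_mem _ h2 hy
  refine (fgRank_le_card hM hcl).trans ((Finset.card_union_le _ _).trans (add_le_add ?_ ?_))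
  · exact Finset.card_image_le.trans (by simp)
  · exact Finset.card_image_le.trans (by simp [hSc])

/-- Freeness of `Kπ` gives a section, hence a retraction `K → L_K`. Its coordinates and the exponent
sums over `Y` map `K` onto a lattice of the required rank. Only a finite part `Y` of the basis is
used, as the basis is not yet known to be finite. -/
theorem latticeRank_add_card_le_fgRank {m n : ℕ} {K : Subgroup (FreeAbTimesFree m n)}
    (hK : K.FG) {X : Type*} (b : FreeGroupBasis X (K.map (freeProj m n))) (Y : Finset X) :
    latticeRank (abelianPart K) + Y.card ≤ fgRank K hK := by
  classical
  have hlift : ∀ q : K.map (freeProj m n), ∃ k : K, (k : FreeAbTimesFree m n).2 = q := by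
    rintro ⟨_, x, hx, rfl⟩
    exact ⟨⟨x, hx⟩, rfl⟩
  choose σ hσ using hlift
  set s : K.map (freeProj m n) →* K := b.lift fun x => σ (b x) with hs
  let p : K →* K.map (freeProj m n) := (freeProj m n).subgroupMap K
  have hbl : ∀ x, s (b x) = σ (b x) := fun x =>
    congrFun (b.lift.symm_apply_apply fun x => σ (b x)) x
  have hps : ∀ q, p (s q) = q := by
    intro q
    have : p.comp s = MonoidHom.id _ := by
      apply b.ext_hom
      intro x
      apply Subtype.ext
      rw [MonoidHom.comp_apply, hbl]
      exact hσ (b x)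
    exact DFunLike.congr_fun this q
  -- `k · s(p k)⁻¹` has trivial free part; the map is multiplicative because `ℤ^m` is commutative.
  let r : K →* abelianPart K :=
    { toFun := fun k => ⟨(k : FreeAbTimesFree m n).1 * (s (p k) : FreeAbTimesFree m n).1⁻¹, by
        have h1 : (s (p k) : FreeAbTimesFree m n).2 = (k : FreeAbTimesFree m n).2 :=
          congrArg Subtype.val (hps (p k))
        have h2 := K.mul_mem k.2 (K.inv_mem (s (p k)).2)
        rw [mem_abelianPart]
        convert h2 using 1
        exact Prod.ext rfl (by simp [h1])⟩
      map_one' := by simp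
      map_mul' := fun x y => by
        apply Subtype.ext
        simp only [Subgroup.coe_mul, map_mul, Prod.fst_mul, mul_inv]
        exact mul_mul_mul_comm _ _ _ _ }
  obtain ⟨f, hf⟩ := exists_lattice_coordinates (abelianPart K)
  let g : K.map (freeProj m n) →* Multiplicative (Y → ℤ) :=
    b.lift fun x => Multiplicative.ofAdd fun y => if x = y then 1 else 0
  have hg : ∀ y : Y, g (b y) = Multiplicative.ofAdd (Pi.single y 1) := by
    intro y
    have : g (b y) = Multiplicative.ofAdd fun y' : Y => if (y : X) = y' then 1 else 0 :=
      congrFun (b.lift.symm_apply_apply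
        fun x => Multiplicative.ofAdd fun y : Y => if x = y then (1 : ℤ) else 0) y
    rw [this]
    congr 1
    ext y'
    rw [Pi.single_apply]
    simp only [Subtype.ext_iff, eq_comm]
  let F : K →* Multiplicative (Fin (latticeRank (abelianPart K)) ⊕ Y → ℤ) :=
    { toFun := fun k => Multiplicative.ofAdd (Sum.elim (f (r k)).toAdd (g (p k)).toAdd)
      map_one' := by
        apply Multiplicative.toAdd.injective
        ext (i | i) <;> simp
      map_mul' := fun x y => by
        apply Multiplicative.toAdd.injective
        ext (i | i) <;> simp }
  have := card_le_fgRank hK F ?_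
  · simpa using this
  rintro (i | y)
  · obtain ⟨a, ha⟩ := hf i
    refine ⟨⟨((a : Multiplicative _), 1), a.2⟩, ?_⟩
    have hp : p ⟨((a : Multiplicative _), 1), a.2⟩ = 1 := Subtype.ext rfl
    have hr : r ⟨((a : Multiplicative _), 1), a.2⟩ = a := by
      apply Subtype.ext
      change (a : Multiplicative _) * (s (p _) : FreeAbTimesFree m n).1⁻¹ = a
      rw [hp, map_one]
      simp
    change Multiplicative.ofAdd (Sum.elim (f (r _)).toAdd (g (p _)).toAdd) = _
    rw [hr, hp, ha, map_one]
    congr 1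
    ext (j | j) <;> simp [Pi.single_apply]
  · refine ⟨s (b y), ?_⟩
    have hr : r (s (b y)) = 1 := by
      apply Subtype.ext
      change (s (b y) : FreeAbTimesFree m n).1 * (s (p (s (b y))) : FreeAbTimesFree m n).1⁻¹ = 1
      rw [hps, mul_inv_cancel]
    change Multiplicative.ofAdd (Sum.elim (f (r _)).toAdd (g (p _)).toAdd) = _
    rw [hr, hps, hg, map_one]
    congr 1
    ext (j | j) <;> simp [Pi.single_apply]

theorem closure_image_freeGroupBasis {G X : Type*} [Group G] [DecidableEq G] [Fintype X]
    {P : Subgroup G} (b : FreeGroupBasis X P) :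
    Subgroup.closure ((Finset.univ.image fun x => (b x : G) : Finset G) : Set G) = P := by
  have hb : Subgroup.closure (Set.range b) = ⊤ := by
    have h1 : Set.range b = b.repr.symm '' Set.range FreeGroup.of := by
      rw [← Set.range_comp]
      rfl
    rw [h1]
    have h2 := MonoidHom.map_closure b.repr.symm.toMonoidHom (Set.range FreeGroup.of)
    rw [FreeGroup.closure_range_of, Subgroup.map_top_of_surjective _ b.repr.symm.surjective] at h2
    exact h2.symm
  rw [Finset.coe_image, Finset.coe_univ, Set.image_univ]
  have h3 := MonoidHom.map_closure P.subtype (Set.range b)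
  rw [hb, ← MonoidHom.range_eq_map, Subgroup.range_subtype, ← Set.range_comp] at h3
  exact h3.symm

theorem latticeRank_add_fgRank_le {m n : ℕ} {K : Subgroup (FreeAbTimesFree m n)} (hK : K.FG)
    (hK' : (K.map (freeProj m n)).FG) :
    latticeRank (abelianPart K) + fgRank (K.map (freeProj m n)) hK' ≤ fgRank K hK := by
  classical
  obtain ⟨X, ⟨b⟩⟩ := IsFreeGroup.nonempty_basis (G := K.map (freeProj m n))
  have hfin : Finite X := by
    by_contra hX
    rw [not_finite_iff_infinite] at hX
    obtain ⟨Y, hY⟩ := Infinite.exists_subset_card_eq X (fgRank K hK + 1)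
    have := latticeRank_add_card_le_fgRank hK b Y
    omega
  have := Fintype.ofFinite X
  refine le_trans (Nat.add_le_add_left ?_ _)
    (latticeRank_add_card_le_fgRank hK b Finset.univ)
  exact (fgRank_le_card hK' (closure_image_freeGroupBasis b)).trans Finset.card_image_le

/-! ### Bounding the quotients, and the case of cyclic `Hπ`. -/

/-- The trivial subgroup contributes `0 / 0 = 1`. -/
theorem one_le_degInertia {G : Type*} [Group G] (H : Subgroup G) : 1 ≤ degInertia H := by
  have h1 : (⊥ : Subgroup G).FG := Subgroup.FG.bot
  have h2 : (H ⊓ ⊥).FG := by rw [inf_bot_eq]; exact h1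
  have h3 : reducedRank (⊥ : Subgroup G) h1 = 0 := by
    rw [reducedRank, (fgRank_eq_zero_iff h1).2 rfl]
  have h4 : reducedRank (H ⊓ ⊥) h2 = 0 := by
    rw [reducedRank, (fgRank_eq_zero_iff h2).2 (inf_bot_eq H)]
  have h5 : rankRatio (reducedRank (H ⊓ ⊥) h2) (reducedRank (⊥ : Subgroup G) h1) = 1 := by
    rw [h3, h4]; simp [rankRatio]
  rw [← h5]
  exact le_iSup_of_le ⊥ (le_iSup_of_le h1 (le_iSup_of_le h2 le_rfl))

theorem rankRatio_le {a b : ℕ} {c : ℝ≥0∞} (hc : 1 ≤ c)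
    (h : (a : ℝ≥0∞) ≤ c * b) : rankRatio a b ≤ c := by
  rw [rankRatio]
  split_ifs with hab
  · exact hc
  · exact ENNReal.div_le_of_le_mul h

/-- If the reduced rank of `(H ∩ K)π` is at most `c` times that of `Kπ`, then the quotient of the
reduced ranks of `H ∩ K` and `K` is at most `c`. -/
theorem rankRatio_inf_le {m n : ℕ} {H K : Subgroup (FreeAbTimesFree m n)} (hK : K.FG)
    (hHK : (H ⊓ K).FG) {c : ℝ≥0∞} (hc : 1 ≤ c)
    (h : 2 ≤ fgRank ((H ⊓ K).map (freeProj m n)) (fg_map_of_fg _ hHK) →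
      (reducedRank ((H ⊓ K).map (freeProj m n)) (fg_map_of_fg _ hHK) : ℝ≥0∞) ≤
        c * reducedRank (K.map (freeProj m n)) (fg_map_of_fg _ hK)) :
    rankRatio (reducedRank (H ⊓ K) hHK) (reducedRank K hK) ≤ c := by
  have hup := fgRank_le_latticeRank_add hHK (fg_map_of_fg (freeProj m n) hHK)
  have hlow := latticeRank_add_fgRank_le hK (fg_map_of_fg (freeProj m n) hK)
  have hL : latticeRank (abelianPart (H ⊓ K)) ≤ latticeRank (abelianPart K) :=
    latticeRank_mono (Subgroup.comap_mono inf_le_right)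
  have hPQ : (H ⊓ K).map (freeProj m n) ≤ K.map (freeProj m n) := Subgroup.map_mono inf_le_right
  have h1 := fgRank_le_one_of_le hPQ (fg_map_of_fg (freeProj m n) hHK)
    (fg_map_of_fg (freeProj m n) hK)
  have h0 : fgRank (K.map (freeProj m n)) (fg_map_of_fg (freeProj m n) hK) = 0 →
      fgRank ((H ⊓ K).map (freeProj m n)) (fg_map_of_fg (freeProj m n) hHK) = 0 := by
    rw [fgRank_eq_zero_iff, fgRank_eq_zero_iff]
    intro hb
    rwa [hb, le_bot_iff] at hPQ
  unfold reducedRank at h ⊢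
  generalize fgRank ((H ⊓ K).map (freeProj m n)) (fg_map_of_fg (freeProj m n) hHK) = q at *
  generalize fgRank (K.map (freeProj m n)) (fg_map_of_fg (freeProj m n) hK) = p at *
  generalize latticeRank (abelianPart K) = t at *
  generalize latticeRank (abelianPart (H ⊓ K)) = t' at *
  generalize fgRank (H ⊓ K) hHK = a at *
  generalize fgRank K hK = b at *
  refine rankRatio_le hc ?_
  -- For `q ≥ 2` also `p ≥ 2`, so no truncation occurs in `q - 1` and `p - 1`. For `q ≤ 1`, `h0`
  -- gives `q ≤ p`, so already `a ≤ b`.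
  by_cases hq : 2 ≤ q
  · have hp : 2 ≤ p := by by_contra hp; have := h1 (by omega); omega
    calc ((a - 1 : ℕ) : ℝ≥0∞) ≤ ((t + (q - 1) : ℕ) : ℝ≥0∞) := by
          exact_mod_cast (by omega : a - 1 ≤ t + (q - 1))
      _ = t + ((q - 1 : ℕ) : ℝ≥0∞) := by push_cast; rfl
      _ ≤ c * t + c * ((p - 1 : ℕ) : ℝ≥0∞) := add_le_add (le_mul_of_one_le_left' hc) (h hq)
      _ = c * ((t + (p - 1) : ℕ) : ℝ≥0∞) := by rw [← mul_add, Nat.cast_add]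
      _ ≤ c * ((b - 1 : ℕ) : ℝ≥0∞) := by
          gcongr
          omega
  · calc ((a - 1 : ℕ) : ℝ≥0∞) ≤ ((b - 1 : ℕ) : ℝ≥0∞) := by
          exact_mod_cast (by omega : a - 1 ≤ b - 1)
      _ ≤ c * ((b - 1 : ℕ) : ℝ≥0∞) := le_mul_of_one_le_left' hc

theorem degInertia_eq_one_of_fgRank_map_le_one {m n : ℕ} {H : Subgroup (FreeAbTimesFree m n)}
    (hH' : (H.map (freeProj m n)).FG) (h : fgRank (H.map (freeProj m n)) hH' ≤ 1) :
    degInertia H = 1 := by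
  refine le_antisymm (iSup_le fun K => iSup_le fun hK => iSup_le fun hHK => ?_)
    (one_le_degInertia H)
  refine rankRatio_inf_le hK hHK le_rfl fun h2 => ?_
  have := fgRank_le_one_of_le (Subgroup.map_mono inf_le_left) (fg_map_of_fg (freeProj m n) hHK)
    hH' h
  omega

/-! ### The case of finite index. -/

/-- The index of `(H ∩ K)π` in `Hπ ∩ Kπ` is at most `[ℤ^m : L_H]`. -/
theorem relIndex_map_inf_le_index_abelianPart {m n : ℕ} (H K : Subgroup (FreeAbTimesFree m n))
    [(abelianPart H).FiniteIndex] :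
    ((H ⊓ K).map (freeProj m n)).relIndex (H.map (freeProj m n) ⊓ K.map (freeProj m n)) ≠ 0 ∧
    ((H ⊓ K).map (freeProj m n)).relIndex (H.map (freeProj m n) ⊓ K.map (freeProj m n)) ≤
      (abelianPart H).index := by
  set P := (H ⊓ K).map (freeProj m n) with hP
  set Q := H.map (freeProj m n) ⊓ K.map (freeProj m n) with hQ
  have hex : ∀ q : Q, ∃ x : FreeAbTimesFree m n × FreeAbTimesFree m n,
      x.1 ∈ H ∧ x.2 ∈ K ∧ x.1.2 = q ∧ x.2.2 = q := by
    rintro ⟨q, ⟨x, hx, hxq⟩, ⟨y, hy, hyq⟩⟩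
    exact ⟨(x, y), hx, hy, hxq, hyq⟩
  choose σ hσH hσK hσ1 hσ2 using hex
  let c : Q → Multiplicative (Fin m → ℤ) ⧸ abelianPart H :=
    fun q => QuotientGroup.mk ((σ q).1.1 * (σ q).2.1⁻¹)
  have hc : ∀ q q' : Q, c q = c q' → (q⁻¹ * q' : Q) ∈ P.subgroupOf Q := by
    intro q q' hqq
    have h1 := QuotientGroup.eq.1 hqq
    rw [mem_abelianPart] at h1
    -- The quotient of the two `K`-lifts differs from that of the `H`-lifts by an element of `L_H`.
    have h2 : (σ q).2⁻¹ * (σ q').2 ∈ H := by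
      have h3 := H.mul_mem (H.mul_mem (H.inv_mem (hσH q)) (hσH q')) (H.inv_mem h1)
      convert h3 using 1
      refine Prod.ext ?_ ?_
      · simp only [Prod.fst_mul, Prod.fst_inv, mul_inv, inv_inv]
        have : ∀ a b x y : Multiplicative (Fin m → ℤ),
            b⁻¹ * y = a⁻¹ * x * (a * b⁻¹ * (x⁻¹ * y)) := by
          intro a b x y
          rw [show a⁻¹ * x * (a * b⁻¹ * (x⁻¹ * y)) = (a⁻¹ * a) * (x * x⁻¹) * (b⁻¹ * y) by
            simp only [mul_assoc, mul_comm, mul_left_comm]]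
          simp
        exact this _ _ _ _
      · simp [hσ1, hσ2]
    refine ⟨(σ q).2⁻¹ * (σ q').2, ⟨h2, K.mul_mem (K.inv_mem (hσK q)) (hσK q')⟩, ?_⟩
    change (σ q).2.2⁻¹ * (σ q').2.2 = _
    rw [hσ2, hσ2]
    rfl
  have hinj : Function.Injective fun x : Q ⧸ P.subgroupOf Q => c x.out := by
    intro x y hxy
    rw [← QuotientGroup.out_eq' x, ← QuotientGroup.out_eq' y]
    exact QuotientGroup.eq.2 (hc _ _ hxy)
  have hfin : Finite (Multiplicative (Fin m → ℤ) ⧸ abelianPart H) := inferInstance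
  have hfin' : Finite (Q ⧸ P.subgroupOf Q) := Finite.of_injective _ hinj
  exact ⟨Nat.card_pos.ne', Nat.card_le_card_of_injective _ hinj⟩

theorem degInertia_le_index_mul {m n : ℕ} (H : Subgroup (FreeAbTimesFree m n))
    [(abelianPart H).FiniteIndex] :
    degInertia H ≤ ((abelianPart H).index : ℝ≥0∞) * degInertia (H.map (freeProj m n)) := by
  have hl : 1 ≤ ((abelianPart H).index : ℝ≥0∞) := by
    exact_mod_cast Nat.one_le_iff_ne_zero.2 Subgroup.FiniteIndex.index_ne_zero
  refine iSup_le fun K => iSup_le fun hK => iSup_le fun hHK => ?_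
  refine rankRatio_inf_le hK hHK (one_le_mul hl (one_le_degInertia _)) fun h2 => ?_
  obtain ⟨hd0, hdl⟩ := relIndex_map_inf_le_index_abelianPart H K
  have hPQ : (H ⊓ K).map (freeProj m n) ≤ H.map (freeProj m n) ⊓ K.map (freeProj m n) :=
    Subgroup.map_inf_le H K _
  have hP := fg_map_of_fg (freeProj m n) hHK
  have hK' := fg_map_of_fg (freeProj m n) hK
  have hQ := hP.of_le_of_relIndex_ne_zero hPQ hd0
  have hr := fgRank_le_relIndex_mul_reducedRank hP hQ hPQ hd0
  -- `Kπ` contains a subgroup of rank at least 2, so it is not cyclic: the quotient is a genuine one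
  -- and can be cleared of its denominator.
  have hKr : reducedRank (K.map (freeProj m n)) hK' ≠ 0 := by
    intro h0
    have := fgRank_le_one_of_le (Subgroup.map_mono inf_le_right) hP hK'
      (by unfold reducedRank at h0; omega)
    omega
  have hdi : rankRatio (reducedRank _ hQ) (reducedRank _ hK') ≤
      degInertia (H.map (freeProj m n)) :=
    le_iSup_of_le _ (le_iSup_of_le hK' (le_iSup_of_le hQ le_rfl))
  rw [rankRatio, if_neg (fun h => hKr h.2), ENNReal.div_le_iff (by exact_mod_cast hKr)
    (ENNReal.natCast_ne_top _)] at hdi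
  calc (reducedRank _ hP : ℝ≥0∞)
      ≤ (((abelianPart H).index * reducedRank _ hQ : ℕ) : ℝ≥0∞) := by
        have h3 := Nat.mul_le_mul_right (reducedRank _ hQ) hdl
        rw [Nat.cast_le, reducedRank]
        omega
    _ = (abelianPart H).index * (reducedRank _ hQ : ℝ≥0∞) := Nat.cast_mul _ _
    _ ≤ _ := by rw [mul_assoc]; gcongr

/-! ### The case of infinite index. -/

/-- Otherwise `A ⧸ L` would be a finitely generated torsion abelian group, hence finite. -/
theorem exists_zpow_mem_imp_eq_zero {A : Type*} [CommGroup A] [Group.FG A] {L : Subgroup A}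
    (hL : ¬ L.FiniteIndex) : ∃ v : A, ∀ k : ℤ, v ^ k ∈ L → k = 0 := by
  by_contra! hcon
  have htor : IsMulTorsion (A ⧸ L) := by
    intro q
    induction q using QuotientGroup.induction_on with
    | H v =>
      obtain ⟨k, hk, hk0⟩ := hcon v
      rw [isOfFinOrder_iff_zpow_eq_one]
      exact ⟨k, hk0, by rw [← QuotientGroup.mk_zpow]; exact (QuotientGroup.eq_one_iff _).2 hk⟩
  have := CommGroup.finite_of_fg_isMulTorsion (A ⧸ L) htor
  exact hL (Subgroup.finiteIndex_of_finite_quotient)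

theorem fgRank_le_fgRank_map {G G' : Type*} [Group G] [Group G'] {f : G →* G'}
    (hf : Function.Injective f) {H : Subgroup G} (hH : H.FG) (hH' : (H.map f).FG) :
    fgRank H hH ≤ fgRank (H.map f) hH' := by
  have : Group.FG H := (Group.fg_iff_subgroup_fg _).2 hH
  have : Group.FG (H.map f) := (Group.fg_iff_subgroup_fg _).2 hH'
  exact Group.rank_le_of_surjective (H.equivMapOfInjective f hf).symm.toMonoidHom
    (H.equivMapOfInjective f hf).symm.surjective

/-- The exponent sum of the second generator of the free group of rank two. -/
def secondExponent : FreeGroup Bool →* Multiplicative ℤ :=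
  FreeGroup.lift fun i => if i then 1 else Multiplicative.ofAdd 1

/-- The exponent sum of the second generator, modulo `N`. -/
def secondExponentMod (N : ℕ) : FreeGroup Bool →* Multiplicative (ZMod N) :=
  (Int.castAddHom (ZMod N)).toMultiplicative.comp secondExponent

theorem mem_ker_secondExponentMod {N : ℕ} {f : FreeGroup Bool} :
    f ∈ (secondExponentMod N).ker ↔ (N : ℤ) ∣ (secondExponent f).toAdd :=
  ZMod.intCast_zmod_eq_zero_iff_dvd _ _

/-- The free group of rank two acts through the wreath product `ℤ ≀ ℤ/N`, whose base group detects
the conjugates of the first generator by powers of the second one. -/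
def toWreath (N : ℕ) :
    FreeGroup Bool →* RegularWreathProduct (Multiplicative ℤ) (Multiplicative (ZMod N)) :=
  FreeGroup.lift fun i =>
    if i then ⟨Pi.mulSingle 1 (Multiplicative.ofAdd 1), 1⟩
    else RegularWreathProduct.inl (Multiplicative.ofAdd 1)

theorem toWreath_right (N : ℕ) (f : FreeGroup Bool) :
    (toWreath N f).right = secondExponentMod N f := by
  have : RegularWreathProduct.rightHom.comp (toWreath N) = secondExponentMod N := by
    ext i
    cases i <;> simp [toWreath, secondExponentMod, secondExponent]
  exact DFunLike.congr_fun this f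

/-- With `x = of true` and `y = of false`, the conjugates `y^j x y^(-j)` lie in the kernel and go to
the `N` basis vectors of the base group of the wreath product. -/
theorem le_fgRank_ker_secondExponentMod (N : ℕ) [NeZero N]
    (h : (secondExponentMod N).ker.FG) : N ≤ fgRank (secondExponentMod N).ker h := by
  -- On the kernel the top component vanishes, so the base component is a homomorphism.
  have hr : ∀ k : (secondExponentMod N).ker, (toWreath N k).right = 1 := fun k => by
    rw [toWreath_right]; exact k.2
  let F : (secondExponentMod N).ker →* Multiplicative (ZMod N → ℤ) :=
    { toFun := fun k => Multiplicative.ofAdd fun z =>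
        ((toWreath N k).left (Multiplicative.ofAdd z)).toAdd
      map_one' := by
        apply Multiplicative.toAdd.injective
        ext z
        simp
      map_mul' := fun a b => by
        apply Multiplicative.toAdd.injective
        ext z
        simp [RegularWreathProduct.mul_left, hr] }
  have := card_le_fgRank h F ?_
  · simpa [ZMod.card] using this
  intro i
  obtain ⟨j, rfl⟩ := ZMod.intCast_surjective i
  have hy : toWreath N (FreeGroup.of false ^ j) =
      RegularWreathProduct.inl (Multiplicative.ofAdd (j : ZMod N)) := by
    rw [map_zpow, toWreath, FreeGroup.lift_apply_of, if_neg (by simp), ← map_zpow,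
      ← ofAdd_zsmul, zsmul_one]
  have hx : toWreath N (FreeGroup.of true) =
      ⟨Pi.mulSingle 1 (Multiplicative.ofAdd 1), 1⟩ := by
    rw [toWreath, FreeGroup.lift_apply_of, if_pos rfl]
  refine ⟨⟨FreeGroup.of false ^ j * FreeGroup.of true * (FreeGroup.of false ^ j)⁻¹, ?_⟩, ?_⟩
  · rw [mem_ker_secondExponentMod]
    simp [secondExponent]
  · apply Multiplicative.toAdd.injective
    ext z
    change ((toWreath N (FreeGroup.of false ^ j * FreeGroup.of true *
      (FreeGroup.of false ^ j)⁻¹)).left (Multiplicative.ofAdd z)).toAdd = _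
    rw [map_mul, map_mul, map_inv, hy, hx]
    simp only [RegularWreathProduct.mul_left, RegularWreathProduct.left_inl,
      RegularWreathProduct.right_inl, RegularWreathProduct.inv_left, Pi.mul_apply, Pi.one_apply,
      Pi.inv_apply, inv_one, mul_one, one_mul, toAdd_ofAdd, Pi.mulSingle_apply, Pi.single_apply]
    have : (Multiplicative.ofAdd (j : ZMod N))⁻¹ * Multiplicative.ofAdd z = 1 ↔ z = j := by
      rw [inv_mul_eq_one, eq_comm]
      exact Multiplicative.ofAdd.injective.eq_iff
    simp only [this]
    split_ifs <;> rfl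

/-- The homomorphism `F₂ × ℤ → ℤ^m × F_n` twisting `φ` by `v` to the exponent sum of the second
generator, and sending the generator of `ℤ` to `v ^ N`. -/
def twist {m n : ℕ} (φ : FreeGroup Bool →* FreeAbTimesFree m n)
    (v : Multiplicative (Fin m → ℤ)) (N : ℕ) :
    FreeGroup Bool × Multiplicative ℤ →* FreeAbTimesFree m n :=
  (((MonoidHom.fst _ _).comp (φ.comp (MonoidHom.fst _ _))) *
    (zpowersHom _ v).comp (secondExponent.comp (MonoidHom.fst _ _)) *
    (zpowersHom _ (v ^ N)).comp (MonoidHom.snd _ _)).prod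
  ((MonoidHom.snd _ _).comp (φ.comp (MonoidHom.fst _ _)))

theorem twist_apply {m n : ℕ} (φ : FreeGroup Bool →* FreeAbTimesFree m n)
    (v : Multiplicative (Fin m → ℤ)) (N : ℕ) (f : FreeGroup Bool) (j : Multiplicative ℤ) :
    twist φ v N (f, j) =
      φ f * ((v ^ ((secondExponent f).toAdd + N * j.toAdd), 1) : FreeAbTimesFree m n) := by
  refine Prod.ext ?_ ?_
  · simp [twist, zpowersHom_apply, zpow_add, zpow_mul, mul_assoc]
  · simp [twist]

theorem exists_generators_range_twist {m n : ℕ} (φ : FreeGroup Bool →* FreeAbTimesFree m n)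
    (v : Multiplicative (Fin m → ℤ)) (N : ℕ) :
    ∃ S : Finset (FreeAbTimesFree m n),
      Subgroup.closure (S : Set (FreeAbTimesFree m n)) = (twist φ v N).range ∧ S.card ≤ 3 := by
  classical
  refine ⟨{twist φ v N (FreeGroup.of true, 1), twist φ v N (FreeGroup.of false, 1),
    twist φ v N (1, Multiplicative.ofAdd 1)}, le_antisymm ?_ ?_, Finset.card_le_three⟩
  · rw [Subgroup.closure_le]
    intro x hx
    simp only [Finset.coe_insert, Finset.coe_singleton, Set.mem_insert_iff,
      Set.mem_singleton_iff] at hx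
    rcases hx with rfl | rfl | rfl <;> exact ⟨_, rfl⟩
  · rintro _ ⟨⟨f, j⟩, rfl⟩
    set T := Subgroup.closure (_ : Set (FreeAbTimesFree m n))
    have h1 : (twist φ v N).comp (MonoidHom.inl _ _) f ∈ T := by
      have : (⊤ : Subgroup (FreeGroup Bool)) ≤
          T.comap ((twist φ v N).comp (MonoidHom.inl _ _)) := by
        rw [← FreeGroup.closure_range_of, Subgroup.closure_le]
        rintro _ ⟨i, rfl⟩
        refine Subgroup.subset_closure ?_
        cases i <;> simp
      exact this trivial
    have h2 : (twist φ v N) (1, j) ∈ T := by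
      have : ((1, j) : FreeGroup Bool × Multiplicative ℤ) =
          (1, Multiplicative.ofAdd 1) ^ j.toAdd := by
        refine Prod.ext (by simp) ?_
        apply Multiplicative.toAdd.injective
        simp
      rw [this, map_zpow]
      exact Subgroup.zpow_mem _ (Subgroup.subset_closure (by simp)) _
    have h3 := T.mul_mem h1 h2
    rw [MonoidHom.comp_apply, ← map_mul] at h3
    simpa using h3

/-- `φ f · v^k` lies in `H` only for `k = 0`; here `k` is the exponent sum of `f` plus a free
multiple of `N`, so `k = 0` is attainable exactly when `N` divides that sum. -/
theorem inf_range_twist {m n : ℕ} {H : Subgroup (FreeAbTimesFree m n)}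
    {φ : FreeGroup Bool →* FreeAbTimesFree m n} (hφ : ∀ f, φ f ∈ H)
    {v : Multiplicative (Fin m → ℤ)} (hv : ∀ k : ℤ, v ^ k ∈ abelianPart H → k = 0) (N : ℕ) :
    H ⊓ (twist φ v N).range = (secondExponentMod N).ker.map φ := by
  apply le_antisymm
  · rintro _ ⟨hx, ⟨⟨f, j⟩, rfl⟩⟩
    rw [twist_apply] at hx
    have h0 := hv _ ((H.mul_mem_cancel_left (hφ f)).1 hx)
    refine ⟨f, mem_ker_secondExponentMod.2 ⟨-j.toAdd, by linarith⟩, ?_⟩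
    rw [twist_apply, h0]
    simp
  · rintro _ ⟨f, hf, rfl⟩
    obtain ⟨j, hj⟩ := mem_ker_secondExponentMod.1 hf
    refine ⟨hφ f, (f, Multiplicative.ofAdd (-j)), ?_⟩
    rw [twist_apply, hj]
    simp

/-- Two basis elements of the free group `Hπ` are lifted to `H`; the lifts are free because their
projections are. -/
theorem exists_injective_freeGroup_bool {m n : ℕ} {H : Subgroup (FreeAbTimesFree m n)}
    (hH' : (H.map (freeProj m n)).FG) (h : 2 ≤ fgRank (H.map (freeProj m n)) hH') :
    ∃ φ : FreeGroup Bool →* FreeAbTimesFree m n, Function.Injective φ ∧ ∀ f, φ f ∈ H := by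
  classical
  obtain ⟨X, ⟨b⟩⟩ := IsFreeGroup.nonempty_basis (G := H.map (freeProj m n))
  have hX : Nontrivial X := by
    by_contra hX
    rw [not_nontrivial_iff_subsingleton] at hX
    have := Fintype.ofFinite X
    have hle : fgRank (H.map (freeProj m n)) hH' ≤ 1 := by
      refine (fgRank_le_card hH'
        (closure_image_freeGroupBasis b)).trans (Finset.card_image_le.trans ?_)
      exact Fintype.card_le_one_iff_subsingleton.2 hX
    omega
  obtain ⟨x, y, hxy⟩ := exists_pair_ne X
  let g : Bool → X := fun i => if i then x else y
  have hg : Function.Injective g := by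
    intro i j hij
    cases i <;> cases j <;> simp_all [g, eq_comm]
  have hlift : ∀ i, ∃ k ∈ H, freeProj m n k = (b (g i) : FreeGroup (Fin n)) :=
    fun i => (b (g i)).2
  choose σ hσH hσ using hlift
  refine ⟨FreeGroup.lift σ, ?_, fun f => ?_⟩
  · have hcomp : (freeProj m n).comp (FreeGroup.lift σ) =
        ((H.map (freeProj m n)).subtype.comp b.repr.symm.toMonoidHom).comp (FreeGroup.map g) := by
      ext i
      rw [MonoidHom.comp_apply, FreeGroup.lift_apply_of, hσ]
      rfl
    have hinj : Function.Injective ((freeProj m n).comp (FreeGroup.lift σ)) := by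
      rw [hcomp]
      exact ((Subgroup.subtype_injective _).comp b.repr.symm.injective).comp
        (FreeGroup.map_injective hg)
    exact Function.Injective.of_comp (f := freeProj m n) hinj
  · have : (FreeGroup.lift σ).range ≤ H := by
      rw [FreeGroup.range_lift_eq_closure, Subgroup.closure_le]
      rintro _ ⟨i, rfl⟩
      exact hσH i
    exact this ⟨f, rfl⟩

theorem natCast_le_rankRatio {M a b : ℕ} (ha : 2 * M ≤ a) (hb : b ≤ 2) :
    (M : ℝ≥0∞) ≤ rankRatio a b := by
  rcases Nat.eq_zero_or_pos M with rfl | hM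
  · simp
  · rw [rankRatio, if_neg (by omega), ENNReal.le_div_iff_mul_le
      (Or.inr (by exact_mod_cast (by omega : a ≠ 0))) (Or.inl (ENNReal.natCast_ne_top b))]
    exact_mod_cast (by nlinarith : M * b ≤ a)

theorem degInertia_eq_top {m n : ℕ} {H : Subgroup (FreeAbTimesFree m n)}
    (hH' : (H.map (freeProj m n)).FG) (h : 2 ≤ fgRank (H.map (freeProj m n)) hH')
    (hL : ¬ (abelianPart H).FiniteIndex) : degInertia H = ∞ := by
  obtain ⟨φ, hφ, hφH⟩ := exists_injective_freeGroup_bool hH' h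
  have : Group.FG (Multiplicative (Fin m → ℤ)) :=
    AddGroup.fg_iff_mul_fg.1 (Module.Finite.iff_addGroup_fg.1 inferInstance)
  obtain ⟨v, hv⟩ := exists_zpow_mem_imp_eq_zero hL
  have hM : ∀ M : ℕ, (M : ℝ≥0∞) ≤ degInertia H := by
    intro M
    -- With `N = 2M + 1` the reduced ranks are at least `2M` above and at most `2` below.
    have hN : NeZero (2 * M + 1) := ⟨by omega⟩
    obtain ⟨S, hS, hSc⟩ := exists_generators_range_twist φ v (2 * M + 1)
    have hK : (twist φ v (2 * M + 1)).range.FG := ⟨S, hS⟩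
    have hker : (secondExponentMod (2 * M + 1)).ker.FG :=
      (Group.fg_iff_subgroup_fg _).1 inferInstance
    have hmap := fg_map_of_fg φ hker
    have hHK : (H ⊓ (twist φ v (2 * M + 1)).range).FG := by
      rw [inf_range_twist hφH hv]; exact hmap
    refine le_trans ?_ (le_iSup_of_le _ (le_iSup_of_le hK (le_iSup_of_le hHK le_rfl)))
    refine natCast_le_rankRatio ?_ ?_
    · have h1 := le_fgRank_ker_secondExponentMod (2 * M + 1) hker
      have h2 := fgRank_le_fgRank_map hφ hker hmap
      rw [reducedRank, fgRank_congr (inf_range_twist hφH hv _) hHK hmap]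
      omega
    · have := fgRank_le_card hK hS
      rw [reducedRank]
      omega
  by_contra htop
  obtain ⟨M, hM'⟩ := ENNReal.exists_nat_gt htop
  exact absurd (hM M) (not_le.2 hM')

theorem theorem1p10 (m n : ℕ) (H : Subgroup (FreeAbTimesFree m n)) (hH : H.FG) :
    (fgRank (H.map (freeProj m n)) (fg_map_of_fg (freeProj m n) hH) ≤ 1 →
      degInertia H = 1) ∧
    (2 ≤ fgRank (H.map (freeProj m n)) (fg_map_of_fg (freeProj m n) hH) →
      ¬ (abelianPart H).FiniteIndex →
      degInertia H = ∞) ∧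
    (2 ≤ fgRank (H.map (freeProj m n)) (fg_map_of_fg (freeProj m n) hH) →
      (abelianPart H).FiniteIndex →
      degInertia H ≤ ((abelianPart H).index : ℝ≥0∞) * degInertia (H.map (freeProj m n))) :=
  ⟨degInertia_eq_one_of_fgRank_map_le_one _, degInertia_eq_top _,
    fun _ _ => degInertia_le_index_mul H⟩
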